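/- A mixed polynomial in $n$ complex variables is a function $h(\mathbf z,\bar{\mathbf z})$ that is a complex polynomial in the coordinates $z_j$ and their conjugates $\bar z_j$. Lemma. Let $\hat f(z_1,z_2,\bar z_1,\bar z_2)$ be a mixed polynomial in two complex variables, let $g=z_2$, and put $C=\{\hat f=0\}$ and $C'=\{z_2=0\}$ in $\mathbb C^2$. Let $f=\hat f|_{z_2=0}$, a mixed polynomial in the single variable $z_1$, and let $\alpha\in\mathbb C$ be an isolated root of $f$, that is, $f(\alpha)=0$ and $f(z_1)\neq 0$ for all $z_1\ne\alpha$ sufficiently near $\alpha$. Put $\hat\alpha=(\alpha,0)$. Then $\hat\alpha\in C\cap C'$, the point $\hat\alpha$ is isolated in $C\cap C'$, and $$I_{top}(C,C';\hat\alpha)=\mathrm{sm}(f,\alpha)\in\mathbb Z .$$ Here $I_{top}(C,C';\hat\alpha)$ is the local intersection number given by the defining polynomials $\hat f,g$: the mapping degree of $$\varphi/\|\varphi\|:S^3_\varepsilon(\hat\alpha)\to S^3,\qquad \varphi=(\mathrm{Re}\,\hat f,\mathrm{Im}\,\hat f,\mathrm{Re}\,g,\mathrm{Im}\,g):\mathbb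 R^4\to\mathbb R^4,$$ where $\mathbb C^2$ is identified with $\mathbb R^4$ by $(z_1,z_2)\leftrightarrow(x_1,y_1,x_2,y_2)$, $z_j=x_j+iy_j$, and $\varepsilon>0$ is such that $\hat\alpha$ is the only point of $C\cap C'$ in the closed ball of radius $\varepsilon$ around $\hat\alpha$. The multiplicity with sign $\mathrm{sm}(f,\alpha)$ is the mapping degree (winding number) of $f/|f|:S^1_{\varepsilon}(\alpha)\to S^1$, where $\varepsilon>0$ is such that $\alpha$ is the only root of $f$ in the closed disk of radius $\varepsilon$ around $\alpha$. Both numbers do not depend on the choice of such an $\varepsilon$. -/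

import Mathlib

noncomputable section

/-- A mixed polynomial in `n` complex variables: a complex polynomial in the variables
`z_j` (the variable `Sum.inl j`) and their conjugates (the variable `Sum.inr j`). -/
abbrev MixedPolynomial (n : ℕ) : Type := MvPolynomial (Fin n ⊕ Fin n) ℂ

namespace MixedPolynomial

/-- The value `f(z, z̄)` of a mixed polynomial at the point `z ∈ ℂⁿ`. -/
def value {n : ℕ} (f : MixedPolynomial n) (z : Fin n → ℂ) : ℂ :=
  MvPolynomial.eval (Sum.elim z (fun j => star (z j))) f

/-- The zero set of a mixed polynomial in `ℂⁿ`. -/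
def zeroSet {n : ℕ} (f : MixedPolynomial n) : Set (Fin n → ℂ) :=
  {z | f.value z = 0}

/-- The holomorphic coordinate `z₂`, as a mixed polynomial in two variables. -/
def z₂ : MixedPolynomial 2 := MvPolynomial.X (Sum.inl 1)

/-- The restriction `F|_{z₂ = 0}`, a mixed polynomial in the one variable `z₁`:
substitute `0` for `z₂` and for its conjugate. -/
def restrictLine (F : MixedPolynomial 2) : MixedPolynomial 1 :=
  MvPolynomial.bind₁
    (Sum.elim ![MvPolynomial.X (Sum.inl 0), 0] ![MvPolynomial.X (Sum.inr 0), 0]) F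

end MixedPolynomial

/-- The identification `ℝ⁴ → ℂ²`, `(x₁, y₁, x₂, y₂) ↦ (x₁ + i y₁, x₂ + i y₂)`. -/
def toComplexPlane (x : EuclideanSpace ℝ (Fin 4)) : Fin 2 → ℂ :=
  ![⟨x 0, x 1⟩, ⟨x 2, x 3⟩]

/-- The identification `ℂ² → ℝ⁴`, inverse to `toComplexPlane`. -/
def toRealSpace (z : Fin 2 → ℂ) : EuclideanSpace ℝ (Fin 4) :=
  !₂[(z 0).re, (z 0).im, (z 1).re, (z 1).im]

/-- The Jacobian determinant at a unit vector `x` of a map `ψ` from the unit sphere of `ℝᵐ` to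
itself, with respect to the outward orientation and the round metric on both spheres. The
derivative at `x` of the radially constant extension `v ↦ ψ (v / ‖v‖)` is the tangent map of `ψ`
on `xᗮ` and kills `x`; adding `v ↦ ⟪x, v⟫ ψ(x)` sends the outward normal `x` at `x` to the
outward normal `ψ x` at `ψ x`, and leaves the tangent map unchanged on `xᗮ`. -/
def sphereJacobian {m : ℕ} (ψ : EuclideanSpace ℝ (Fin m) → EuclideanSpace ℝ (Fin m))
    (x : EuclideanSpace ℝ (Fin m)) : ℝ :=
  (fderiv ℝ (fun v => ψ (‖v‖⁻¹ • v)) x + (innerSL ℝ x).smulRight (ψ x)).det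

/-- The mapping degree of a smooth map `ψ` of the unit sphere `S` of `ℝᵐ` to itself,
`deg ψ = (∫_S ψ^* ω) / (∫_S ω)` with `ω` the volume form of the sphere: the average of the Jacobian
determinant of `ψ` over the sphere with its surface measure. -/
def mappingDegree {m : ℕ} (ψ : EuclideanSpace ℝ (Fin m) → EuclideanSpace ℝ (Fin m)) : ℝ :=
  ⨍ x, sphereJacobian ψ (x : EuclideanSpace ℝ (Fin m))
    ∂((MeasureTheory.volume : MeasureTheory.Measure (EuclideanSpace ℝ (Fin m))).toSphere)

/-- The map `φ = (Re F, Im F, Re G, Im G) : ℝ⁴ → ℝ⁴`. -/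
def realPair (F G : MixedPolynomial 2) (x : EuclideanSpace ℝ (Fin 4)) :
    EuclideanSpace ℝ (Fin 4) :=
  toRealSpace ![F.value (toComplexPlane x), G.value (toComplexPlane x)]

/-- The normalized map `φ / ‖φ‖ : S_ε(P) → S³`, where `S_ε(P)` is parametrized by
the unit sphere through `x ↦ P + ε x`. -/
def normalizedPair (F G : MixedPolynomial 2) (P : Fin 2 → ℂ) (ε : ℝ)
    (x : EuclideanSpace ℝ (Fin 4)) : EuclideanSpace ℝ (Fin 4) :=
  ‖realPair F G (toRealSpace P + ε • x)‖⁻¹ • realPair F G (toRealSpace P + ε • x)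

/-- `P` is the only common zero of `F` and `G` in the closed ball of radius `ε` around `P`. -/
def IsOnlyIntersection (F G : MixedPolynomial 2) (P : Fin 2 → ℂ) (ε : ℝ) : Prop :=
  ∀ x ∈ Metric.closedBall (toRealSpace P) ε,
    toComplexPlane x ∈ F.zeroSet ∩ G.zeroSet ↔ x = toRealSpace P

/-- `P` is an isolated intersection point of `C : F = 0` and `C' : G = 0`, and the local
intersection number `I_top(C, C'; P)` is well defined and equal to `n`: on every sphere around `P`
bounding a ball in which `P` is the only intersection point, the normalized map of
`(Re F, Im F, Re G, Im G)` has mapping degree `n`. -/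
def HasIntersectionNumber (F G : MixedPolynomial 2) (P : Fin 2 → ℂ) (n : ℤ) : Prop :=
  (∃ ε > 0, IsOnlyIntersection F G P ε) ∧
    ∀ ε > 0, IsOnlyIntersection F G P ε → mappingDegree (normalizedPair F G P ε) = n

/-- The loop `γ : ℝ/2πℤ → S¹` has mapping degree (winding number) `n`: a continuous choice of its
argument grows by `2πn` over one period. -/
def HasWindingNumber (γ : ℝ → ℂ) (n : ℤ) : Prop :=
  ∃ θ : ℝ → ℝ, Continuous θ ∧ (∀ t, γ t = Complex.exp (θ t * Complex.I)) ∧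
    θ (2 * Real.pi) - θ 0 = 2 * Real.pi * n

/-- `α` is the only zero of `f` in the closed disk of radius `ε` around `α`. -/
def IsOnlyRoot (f : MixedPolynomial 1) (α : ℂ) (ε : ℝ) : Prop :=
  ∀ z ∈ Metric.closedBall α ε, f.value ![z] = 0 ↔ z = α

/-- The normalized map `f / |f| : S¹_ε(α) → S¹`, where the circle is parametrized by
`t ↦ α + ε e^{it}`. -/
def normalizedLoop (f : MixedPolynomial 1) (α : ℂ) (ε : ℝ) (t : ℝ) : ℂ :=
  f.value ![circleMap α ε t] / ‖f.value ![circleMap α ε t]‖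

/-- `α` is an isolated root of `f`, and the multiplicity with sign `sm(f, α)` is well defined and
equal to `n`: on every circle around `α` bounding a disk in which `α` is the only root, the
normalized map `f / |f|` has mapping degree `n`. -/
def HasSignedMultiplicity (f : MixedPolynomial 1) (α : ℂ) (n : ℤ) : Prop :=
  (∃ ε > 0, IsOnlyRoot f α ε) ∧
    ∀ ε > 0, IsOnlyRoot f α ε → HasWindingNumber (normalizedLoop f α ε) n

end

/-!
Let `φ` be the rescaled pair `(F, z₂)` on the unit sphere `S³`, and extend it to a map `Ψ` of `ℝ⁴`,
positively homogeneous of degree one. In polar coordinates, `∫ exp (-‖Ψ‖²) det DΨ` is the mapping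
degree of `φ / ‖φ‖` times the Gaussian integral `π²`. Since `Ψ` preserves the coordinate `z₂`, both
the Gaussian and the determinant split along the complex lines `z₂ = b`, and Fubini's theorem
reduces the integral to planar ones. On such a line, Stokes' theorem turns the Gaussian integral
into the flux of `(1 - exp (-|w|²)) / 2 · Im (dw / w)` through large circles. These circles,
rescaled to the unit sphere, approach the unit circle of the line `z₂ = 0`, so the flux tends to `π`
times the winding number of `f`. The remaining Gaussian integral over `b` is `π`.
-/

open MeasureTheory Set Filter Topology Complex ComplexConjugate

/-! ### Stokes' theorem in the plane -/

theorem alternatingMap_comp_basis {R M ι : Type*} [CommRing R] [AddCommGroup M] [Module R M]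
    [Finite ι] (f : M [⋀^ι]→ₗ[R] R) (L : M →ₗ[R] M) (e : Module.Basis ι R M) :
    f (L ∘ e) = LinearMap.det L * f e := by
  classical
  cases nonempty_fintype ι
  rw [f.eq_smul_basis_det e]
  simp [e.det_comp, e.det_self, mul_comm]

theorem alternatingMap_complex_apply (f : ℂ [⋀^Fin 2]→ₗ[ℝ] ℝ) (v w : ℂ) :
    f ![v, w] = (conj v * w).im * f ![1, I] := by
  have hdet : Complex.basisOneI.det ![v, w] = (conj v * w).im := by
    simp [Module.Basis.det_apply, Matrix.det_fin_two, Module.Basis.toMatrix_apply, mul_comm,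
      add_comm, sub_eq_add_neg]
  rw [f.eq_smul_basis_det Complex.basisOneI, AlternatingMap.smul_apply, hdet,
    ← Complex.coe_basisOneI, AlternatingMap.smul_apply, Complex.basisOneI.det_self, smul_eq_mul,
    smul_eq_mul, mul_one, mul_comm]

theorem compContinuousLinearMap_vecOne {E E' F : Type*} [NormedAddCommGroup E] [NormedSpace ℝ E]
    [NormedAddCommGroup E'] [NormedSpace ℝ E'] [NormedAddCommGroup F] [NormedSpace ℝ F]
    (ω : E' [⋀^Fin 1]→L[ℝ] F) (L : E →L[ℝ] E') (v : E) :
    ω.compContinuousLinearMap L ![v] = ω ![L v] :=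
  congrArg ω (FinVec.map_eq L ![v]).symm

theorem compContinuousLinearMap_vecTwo {E E' F : Type*} [NormedAddCommGroup E] [NormedSpace ℝ E]
    [NormedAddCommGroup E'] [NormedSpace ℝ E'] [NormedAddCommGroup F] [NormedSpace ℝ F]
    (ω : E' [⋀^Fin 2]→L[ℝ] F) (L : E →L[ℝ] E') (v w : E) :
    ω.compContinuousLinearMap L ![v, w] = ω ![L v, L w] :=
  congrArg ω (FinVec.map_eq L ![v, w]).symm

theorem extDeriv_one_form_apply {E F : Type*} [NormedAddCommGroup E] [NormedSpace ℝ E]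
    [NormedAddCommGroup F] [NormedSpace ℝ F] {ω : E → E [⋀^Fin 1]→L[ℝ] F} {x : E}
    (hω : DifferentiableAt ℝ ω x) (v w : E) :
    extDeriv ω x ![v, w] =
      fderiv ℝ (fun y => ω y ![w]) x v - fderiv ℝ (fun y => ω y ![v]) x w := by
  have h0 : (0 : Fin 2).removeNth ![v, w] = ![w] := by ext i; fin_cases i; rfl
  have h1 : (1 : Fin 2).removeNth ![v, w] = ![v] := by ext i; fin_cases i; rfl
  simp [extDeriv_apply hω, Fin.sum_univ_two, h0, h1, sub_eq_add_neg]

theorem integral_extDeriv_rectangle {F : Type*} [NormedAddCommGroup F] [NormedSpace ℝ F]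
    {ω : ℝ × ℝ → (ℝ × ℝ) [⋀^Fin 1]→L[ℝ] F} (hω : ContDiff ℝ 1 ω) (a b c d : ℝ) :
    (∫ x in a..b, ∫ y in c..d, extDeriv ω (x, y) ![(1, 0), (0, 1)]) =
      (((∫ x in a..b, ω (x, c) ![(1, 0)]) - ∫ x in a..b, ω (x, d) ![(1, 0)]) +
        ∫ y in c..d, ω (b, y) ![(0, 1)]) - ∫ y in c..d, ω (a, y) ![(0, 1)] := by
  have hdiff : Differentiable ℝ ω := hω.differentiable one_ne_zero
  have hω_apply (v : ℝ × ℝ) : ContDiff ℝ 1 fun p => ω p ![v] :=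
    (ContinuousAlternatingMap.apply ℝ (ℝ × ℝ) F ![v]).contDiff.comp hω
  have hP := hω_apply (0, 1)
  have hQ := (hω_apply (1, 0)).neg
  have hdP (p) := (hP.differentiable one_ne_zero p).hasFDerivAt
  have hdQ (p) := (hQ.differentiable one_ne_zero p).hasFDerivAt
  have hcont : Continuous fun p : ℝ × ℝ => fderiv ℝ (fun q => ω q ![(0, 1)]) p (1, 0) +
      fderiv ℝ (fun q => -ω q ![(1, 0)]) p (0, 1) :=
    ((hP.continuous_fderiv one_ne_zero).clm_apply continuous_const).add
      ((hQ.continuous_fderiv one_ne_zero).clm_apply continuous_const)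
  have key := integral2_divergence_prod_of_hasFDerivAt _ _ _ _ a c b d
    hP.continuous.continuousOn hQ.continuous.continuousOn (fun p _ => hdP p) (fun p _ => hdQ p)
    (hcont.continuousOn.integrableOn_compact (isCompact_uIcc.prod isCompact_uIcc))
  simp only [fderiv_fun_neg, neg_apply, ← sub_eq_add_neg,
    ← extDeriv_one_form_apply (hdiff _), intervalIntegral.integral_neg] at key
  rw [key]
  abel

theorem contDiff_polarCoord_symm {n : WithTop ℕ∞} : ContDiff ℝ n Complex.polarCoord.symm := by
  have h : ⇑Complex.polarCoord.symm =
      fun p : ℝ × ℝ => (p.1 : ℂ) * (Real.cos p.2 + Real.sin p.2 * I) := by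
    ext p
    exact Complex.polarCoord_symm_apply p
  have hof : ContDiff ℝ n fun x : ℝ => (x : ℂ) := ofRealCLM.contDiff
  rw [h]
  exact (hof.comp contDiff_fst).mul ((hof.comp (Real.contDiff_cos.comp contDiff_snd)).add
    ((hof.comp (Real.contDiff_sin.comp contDiff_snd)).mul contDiff_const))

theorem polarCoord_symm_eq_circleMap (r t : ℝ) :
    Complex.polarCoord.symm (r, t) = circleMap 0 r t := by
  simp [circleMap, Complex.exp_mul_I]

theorem fderiv_polarCoord_symm_fst (r t : ℝ) :
    fderiv ℝ Complex.polarCoord.symm (r, t) (1, 0) = circleMap 0 1 t := by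
  have hline : HasDerivAt (fun s : ℝ => (s, t)) (1, 0) r :=
    (hasDerivAt_id r).prodMk (hasDerivAt_const r t)
  have hray : HasDerivAt (fun s : ℝ => circleMap 0 s t) (circleMap 0 1 t) r := by
    simpa [circleMap] using! (hasDerivAt_id r).ofReal_comp.mul_const (exp (t * I))
  have := ((contDiff_polarCoord_symm.differentiable one_ne_zero (r, t)).hasFDerivAt.comp_hasDerivAt
    r hline)
  simp only [Function.comp_def, polarCoord_symm_eq_circleMap] at this
  exact this.unique hray

theorem fderiv_polarCoord_symm_snd (r t : ℝ) :
    fderiv ℝ Complex.polarCoord.symm (r, t) (0, 1) = circleMap 0 r t * I := by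
  have hline : HasDerivAt (fun s : ℝ => (r, s)) (0, 1) t :=
    (hasDerivAt_const t r).prodMk (hasDerivAt_id t)
  have := ((contDiff_polarCoord_symm.differentiable one_ne_zero (r, t)).hasFDerivAt.comp_hasDerivAt
    t hline)
  simp only [Function.comp_def, polarCoord_symm_eq_circleMap] at this
  exact this.unique (hasDerivAt_circleMap 0 r t)

theorem contDiff_pullback_one_form {E E' F : Type*} [NormedAddCommGroup E] [NormedSpace ℝ E]
    [NormedAddCommGroup E'] [NormedSpace ℝ E'] [NormedAddCommGroup F] [NormedSpace ℝ F]
    {ω : E' → E' [⋀^Fin 1]→L[ℝ] F} {f : E → E'} {n : WithTop ℕ∞} (hω : ContDiff ℝ n ω)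
    (hf : ContDiff ℝ (n + 1) f) :
    ContDiff ℝ n fun x => (ω (f x)).compContinuousLinearMap (fderiv ℝ f x) := by
  let e := ContinuousAlternatingMap.ofSubsingletonLIE (𝕜 := ℝ) (E := E) (F := F) (0 : Fin 1)
  let e' := ContinuousAlternatingMap.ofSubsingletonLIE (𝕜 := ℝ) (E := E') (F := F) (0 : Fin 1)
  have hdf : ContDiff ℝ n (fderiv ℝ f) := hf.fderiv_right le_rfl
  have hcomp : ContDiff ℝ n fun x => (e'.symm (ω (f x))).comp (fderiv ℝ f x) :=
    (e'.symm.contDiff.comp (hω.comp (hf.of_le le_self_add))).clm_comp hdf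
  convert e.contDiff.comp hcomp using 2 with x
  rw [Function.comp_apply, ← e'.apply_symm_apply (ω (f x)), e'.symm_apply_apply]
  rfl

theorem integral_extDeriv_disc {ω : ℂ → ℂ [⋀^Fin 1]→L[ℝ] ℝ} (hω : ContDiff ℝ 1 ω) (R : ℝ) :
    (∫ r in (0 : ℝ)..R, ∫ t in (-Real.pi)..Real.pi,
      r * extDeriv ω (circleMap 0 r t) ![1, I]) =
    ∫ t in (-Real.pi)..Real.pi, ω (circleMap 0 R t) ![circleMap 0 R t * I] := by
  have hpolar : ContDiff ℝ 2 Complex.polarCoord.symm := contDiff_polarCoord_symm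
  let η : ℝ × ℝ → (ℝ × ℝ) [⋀^Fin 1]→L[ℝ] ℝ := fun p =>
    (ω (Complex.polarCoord.symm p)).compContinuousLinearMap (fderiv ℝ Complex.polarCoord.symm p)
  have hη : ContDiff ℝ 1 η := contDiff_pullback_one_form hω hpolar
  have hη_apply (r t : ℝ) (v : ℝ × ℝ) : η (r, t) ![v] =
      ω (circleMap 0 r t) ![fderiv ℝ Complex.polarCoord.symm (r, t) v] := by
    simp only [η, polarCoord_symm_eq_circleMap, compContinuousLinearMap_vecOne]
  have hdη (r t : ℝ) :
      extDeriv η (r, t) ![(1, 0), (0, 1)] = r * extDeriv ω (circleMap 0 r t) ![1, I] := by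
    have hunit : conj (circleMap 0 1 t) * (circleMap 0 r t * I) = r * I := by
      have hconj : conj (circleMap 0 1 t) * circleMap 0 1 t = 1 := by
        rw [conj_mul']
        simp
      calc conj (circleMap 0 1 t) * (circleMap 0 r t * I)
          = r * (conj (circleMap 0 1 t) * circleMap 0 1 t) * I := by
            simp only [circleMap, zero_add, ofReal_one, one_mul]
            ring
        _ = r * I := by rw [hconj, mul_one]
    rw [extDeriv_pullback (hω.differentiable one_ne_zero _) hpolar.contDiffAt (by simp),
      compContinuousLinearMap_vecTwo, polarCoord_symm_eq_circleMap,
      fderiv_polarCoord_symm_fst, fderiv_polarCoord_symm_snd,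
      ← ContinuousAlternatingMap.coe_toAlternatingMap, alternatingMap_complex_apply, hunit]
    simp
  have hper (r : ℝ) : circleMap 0 r Real.pi = circleMap 0 r (-Real.pi) := by
    simpa [two_mul] using! periodic_circleMap 0 r (-Real.pi)
  have hzero (t : ℝ) : ω (circleMap 0 0 t) ![circleMap 0 0 t * I] = 0 :=
    (ω _).map_coord_zero 0 (by simp)
  have key := integral_extDeriv_rectangle hη 0 R (-Real.pi) Real.pi
  simpa only [hdη, hη_apply, fderiv_polarCoord_symm_fst, fderiv_polarCoord_symm_snd, hper, hzero,
    sub_self, zero_add, intervalIntegral.integral_zero, sub_zero] using key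

theorem integrableOn_polarCoord_target {k : ℂ → ℝ} (hk : Continuous k) (hint : Integrable k) :
    IntegrableOn (fun p => p.1 * k (Complex.polarCoord.symm p)) polarCoord.target := by
  have hpolar : Continuous Complex.polarCoord.symm :=
    (contDiff_polarCoord_symm (n := 0)).continuous
  refine ⟨(continuous_fst.mul (hk.comp hpolar)).aestronglyMeasurable, ?_⟩
  rw [hasFiniteIntegral_iff_enorm]
  have hfin := hasFiniteIntegral_iff_enorm.1 hint.hasFiniteIntegral
  rw [← Complex.lintegral_comp_polarCoord_symm] at hfin
  refine (setLIntegral_congr_fun polarCoord.open_target.measurableSet fun p hp => ?_).trans_lt hfin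
  have hpos : 0 < p.1 := hp.1
  simp only [enorm_mul, smul_eq_mul, Real.enorm_of_nonneg hpos.le]

theorem tendsto_integral_disc {k : ℂ → ℝ} (hk : Continuous k) (hint : Integrable k) :
    Tendsto (fun R => ∫ r in (0 : ℝ)..R, ∫ t in (-Real.pi)..Real.pi, r * k (circleMap 0 r t))
      atTop (𝓝 (∫ z, k z)) := by
  have hprod := integrableOn_polarCoord_target hk hint
  rw [← Complex.integral_comp_polarCoord_symm]
  rw [IntegrableOn] at hprod
  rw [polarCoord_target, Measure.volume_eq_prod, ← Measure.prod_restrict] at hprod ⊢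
  simp only [smul_eq_mul]
  rw [integral_prod _ hprod]
  refine (intervalIntegral_tendsto_integral_Ioi 0 hprod.integral_prod_left tendsto_id).congr
    fun R => intervalIntegral.integral_congr fun r _ => ?_
  simp only [polarCoord_symm_eq_circleMap]
  rw [intervalIntegral.integral_of_le (by linarith [Real.pi_pos]), integral_Ioc_eq_integral_Ioo]

theorem integral_extDeriv_plane {ω : ℂ → ℂ [⋀^Fin 1]→L[ℝ] ℝ} (hω : ContDiff ℝ 1 ω)
    (hint : Integrable fun z => extDeriv ω z ![1, I]) {L : ℝ}
    (hL : Tendsto (fun R => ∫ t in (-Real.pi)..Real.pi,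
      ω (circleMap 0 R t) ![circleMap 0 R t * I]) atTop (𝓝 L)) :
    ∫ z, extDeriv ω z ![1, I] = L := by
  have hcont : Continuous fun z => extDeriv ω z ![1, I] :=
    (ContinuousAlternatingMap.apply ℝ ℂ ℝ ![1, I]).continuous.comp
      ((ContinuousAlternatingMap.alternatizeUncurryFinCLM ℝ ℂ ℝ).continuous.comp
        (hω.continuous_fderiv one_ne_zero))
  refine tendsto_nhds_unique (tendsto_integral_disc hcont hint) ?_
  simpa only [integral_extDeriv_disc hω] using hL

theorem extDeriv_pullback_complex {ω : ℂ → ℂ [⋀^Fin 1]→L[ℝ] ℝ} {g : ℂ → ℂ} {z : ℂ}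
    (hω : DifferentiableAt ℝ ω (g z)) (hg : ContDiffAt ℝ 2 g z) :
    extDeriv (fun z => (ω (g z)).compContinuousLinearMap (fderiv ℝ g z)) z ![1, I] =
      (fderiv ℝ g z).det * extDeriv ω (g z) ![1, I] := by
  rw [extDeriv_pullback hω hg (by simp), ← Complex.coe_basisOneI]
  exact alternatingMap_comp_basis (extDeriv ω (g z)).toAlternatingMap (fderiv ℝ g z).toLinearMap _

/-! ### The Gaussian flux of a loop -/

/-- The rotation-invariant `1`-form `φ(|w|²) (x dy - y dx) / 2` on the plane, `w = x + i y`. -/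
noncomputable def angularForm (φ : ℝ → ℝ) (w : ℂ) : ℂ [⋀^Fin 1]→L[ℝ] ℝ :=
  .ofSubsingleton ℝ ℂ ℝ 0
    ((φ (‖w‖ ^ 2) / 2) • imCLM.comp (ContinuousLinearMap.mul ℝ ℂ (conj w)))

@[simp]
theorem angularForm_apply (φ : ℝ → ℝ) (w v : ℂ) :
    angularForm φ w ![v] = φ (‖w‖ ^ 2) / 2 * (conj w * v).im := by
  simp [angularForm]

theorem contDiff_angularForm {φ : ℝ → ℝ} {n : WithTop ℕ∞} (hφ : ContDiff ℝ n φ) :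
    ContDiff ℝ n (angularForm φ) :=
  (ContinuousAlternatingMap.ofSubsingletonLIE (𝕜 := ℝ) (E := ℂ) (F := ℝ)
    (0 : Fin 1)).toContinuousLinearEquiv.contDiff.comp
    (((hφ.comp (contDiff_norm_sq ℝ)).div_const 2).smul (contDiff_const.clm_comp
      ((ContinuousLinearMap.mul ℝ ℂ).contDiff.comp conjCLE.contDiff)))

theorem extDeriv_angularForm {φ : ℝ → ℝ} (hφ : ContDiff ℝ 1 φ) (w : ℂ) :
    extDeriv (angularForm φ) w ![1, I] = deriv (fun s => s * φ s) (‖w‖ ^ 2) := by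
  have hφ' := (hφ.differentiable one_ne_zero (‖w‖ ^ 2)).hasDerivAt
  have hscale : HasFDerivAt (fun w : ℂ => φ (‖w‖ ^ 2) / 2)
      (deriv φ (‖w‖ ^ 2) • innerSL ℝ w) w := by
    have hcomp := (hφ'.div_const 2).comp_hasFDerivAt w (hasStrictFDerivAt_norm_sq w).hasFDerivAt
    exact hcomp.congr_fderiv (by module)
  have h1 := hscale.mul (imCLM.hasFDerivAt (x := w)).neg
  have hI := hscale.mul (reCLM.hasFDerivAt (x := w))
  rw [extDeriv_one_form_apply ((contDiff_angularForm hφ).differentiable one_ne_zero w),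
    HasFDerivAt.fderiv (by simpa using! hI), HasFDerivAt.fderiv (by simpa using! h1)]
  rw [((hasDerivAt_id' _).fun_mul hφ').deriv]
  simp [← normSq_eq_norm_sq, normSq_apply]
  ring

theorem analyticAt_dslope {𝕜 E : Type*} [NontriviallyNormedField 𝕜] [NormedAddCommGroup E]
    [NormedSpace 𝕜 E] {f : 𝕜 → E} {a b : 𝕜} (ha : AnalyticAt 𝕜 f a) (hb : AnalyticAt 𝕜 f b) :
    AnalyticAt 𝕜 (dslope f a) b := by
  rcases eq_or_ne b a with rfl | hne
  · obtain ⟨p, hp⟩ := ha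
    exact hp.has_fpower_series_dslope_fslope.analyticAt
  · refine AnalyticAt.congr ?_ (dslope_eventuallyEq_slope_of_ne f hne).symm
    simp only [slope_fun_def, vsub_eq_sub]
    exact ((analyticAt_id.sub analyticAt_const).inv (sub_ne_zero.2 hne)).smul
      (hb.sub analyticAt_const)

theorem exists_contDiff_mul_eq_one_sub_exp_neg :
    ∃ φ : ℝ → ℝ, ContDiff ℝ 1 φ ∧ ∀ s, s * φ s = 1 - Real.exp (-s) := by
  have han (s : ℝ) : AnalyticAt ℝ (fun s => -Real.exp (-s)) s := analyticAt_id.neg.rexp.neg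
  refine ⟨dslope (fun s => -Real.exp (-s)) 0,
    contDiff_iff_contDiffAt.2 fun s => (analyticAt_dslope (han 0) (han s)).contDiffAt, fun s => ?_⟩
  simpa [neg_add_eq_sub] using sub_smul_dslope (fun s => -Real.exp (-s)) 0 s

/-- The flux of the primitive `(1 - exp (-|w|²)) / 2 · Im (dw / w)` of the Gaussian `2`-form through
the loop `σ^(-1/2) γ`, extended by its limit to `σ = 0`. -/
noncomputable def gaussianFlux (σ : ℝ) (γ : ℝ → ℂ) : ℝ :=
  ∫ t in (-Real.pi)..Real.pi, (1 - expNegInvGlue (σ / ‖γ t‖ ^ 2)) / 2 * (logDeriv γ t).im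

theorem gaussianFlux_zero (γ : ℝ → ℂ) :
    gaussianFlux 0 γ = (∫ t in (-Real.pi)..Real.pi, (logDeriv γ t).im) / 2 := by
  simp only [gaussianFlux, zero_div, expNegInvGlue.zero, sub_zero,
    intervalIntegral.integral_const_mul]
  ring

theorem logDeriv_const_mul_apply {c : ℂ} (hc : c ≠ 0) (γ : ℝ → ℂ) (t : ℝ) :
    logDeriv (fun t => c * γ t) t = logDeriv γ t := by
  simp only [logDeriv_apply, deriv_const_mul_field', mul_div_mul_left _ _ hc]

theorem gaussianFlux_const_mul {c : ℂ} (hc : c ≠ 0) (σ : ℝ) (γ : ℝ → ℂ) :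
    gaussianFlux σ (fun t => c * γ t) = gaussianFlux (σ / ‖c‖ ^ 2) γ := by
  simp only [gaussianFlux, logDeriv_const_mul_apply hc, norm_mul, mul_pow, div_div]

theorem expNegInvGlue_inv {s : ℝ} (hs : 0 < s) : expNegInvGlue s⁻¹ = Real.exp (-s) := by
  rw [expNegInvGlue, if_neg (inv_pos.2 hs).not_ge, inv_inv]

theorem im_conj_mul_eq (w v : ℂ) : (conj w * v).im = ‖w‖ ^ 2 * (v / w).im := by
  rcases eq_or_ne w 0 with rfl | hw
  · simp
  · rw [← im_ofReal_mul, ofReal_pow, ← conj_mul', mul_assoc, mul_div_cancel₀ _ hw]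

theorem integral_gaussian_mul_det_eq_of_tendsto {g : ℂ → ℂ} (hg : ContDiff ℝ 2 g)
    (hint : Integrable fun z => Real.exp (-‖g z‖ ^ 2) * (fderiv ℝ g z).det) {L : ℝ}
    (hL : Tendsto (fun R => gaussianFlux 1 fun t => g (circleMap 0 R t)) atTop (𝓝 L)) :
    ∫ z, Real.exp (-‖g z‖ ^ 2) * (fderiv ℝ g z).det = L := by
  obtain ⟨φ, hφ, hφ_mul⟩ := exists_contDiff_mul_eq_one_sub_exp_neg
  have hω := contDiff_angularForm hφ
  have hdω (z : ℂ) : extDeriv (fun z => (angularForm φ (g z)).compContinuousLinearMap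
      (fderiv ℝ g z)) z ![1, I] = Real.exp (-‖g z‖ ^ 2) * (fderiv ℝ g z).det := by
    rw [extDeriv_pullback_complex (hω.differentiable one_ne_zero _) hg.contDiffAt,
      extDeriv_angularForm hφ, funext hφ_mul, mul_comm]
    congr 1
    simpa using! ((hasDerivAt_neg (‖g z‖ ^ 2)).exp.const_sub 1).deriv
  have hflux (R : ℝ) : (∫ t in (-Real.pi)..Real.pi, (angularForm φ
      (g (circleMap 0 R t))).compContinuousLinearMap (fderiv ℝ g (circleMap 0 R t))
        ![circleMap 0 R t * I]) = gaussianFlux 1 fun t => g (circleMap 0 R t) := by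
    refine intervalIntegral.integral_congr fun t _ => ?_
    have hderiv : deriv (fun t => g (circleMap 0 R t)) t =
        fderiv ℝ g (circleMap 0 R t) (circleMap 0 R t * I) :=
      ((hg.differentiable two_ne_zero _).hasFDerivAt.comp_hasDerivAt t
        (hasDerivAt_circleMap 0 R t)).deriv
    simp only [compContinuousLinearMap_vecOne, angularForm_apply, im_conj_mul_eq, logDeriv_apply,
      hderiv]
    rcases eq_or_ne (g (circleMap 0 R t)) 0 with h0 | h0
    · simp [h0]
    · rw [one_div, expNegInvGlue_inv (by positivity), ← hφ_mul]
      ring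
  simp only [← hdω] at hint ⊢
  refine integral_extDeriv_plane (contDiff_pullback_one_form hω (by exact_mod_cast hg)) hint ?_
  simpa only [hflux] using hL

theorem continuousAt_intervalIntegral {X E : Type*} [TopologicalSpace X]
    [FirstCountableTopology X] [NormedAddCommGroup E] [NormedSpace ℝ E]
    {φ : X → ℝ → E} {x₀ : X} {a b : ℝ}
    (hm : ∀ x, AEStronglyMeasurable (φ x))
    (hφ : ∀ t, ContinuousAt (fun p : X × ℝ => φ p.1 p.2) (x₀, t)) :
    ContinuousAt (fun x => ∫ t in a..b, φ x t) x₀ := by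
  have hc : Continuous (φ x₀) := continuous_iff_continuousAt.2 fun t =>
    (hφ t).comp (f := fun t => (x₀, t)) (by fun_prop)
  have hbound : ∀ᶠ x in 𝓝 x₀, ∀ t ∈ uIcc a b, ‖φ x t‖ ≤ ‖φ x₀ t‖ + 1 := by
    refine isCompact_uIcc.eventually_forall_of_forall_eventually fun t _ => ?_
    have hdiff : ContinuousAt (fun p : X × ℝ => ‖φ p.1 p.2‖ - ‖φ x₀ p.2‖) (x₀, t) :=
      (hφ t).norm.sub (by fun_prop)
    filter_upwards [hdiff.eventually_lt_const (by simp : _ < (1 : ℝ))] with p hp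
    linarith
  refine intervalIntegral.continuousAt_of_dominated_interval
    (bound := fun t => ‖φ x₀ t‖ + 1)
    (.of_forall fun x => (hm x).restrict) ?_ ((hc.norm.add continuous_const).intervalIntegrable _ _)
    (ae_of_all _ fun t _ => (hφ t).comp (f := fun x => (x, t))
      (Continuous.prodMk_left t).continuousAt)
  filter_upwards [hbound] with x hx
  exact ae_of_all _ fun t ht => hx t (uIoc_subset_uIcc ht)

theorem continuousAt_gaussianFlux {X : Type*} [TopologicalSpace X] [FirstCountableTopology X]
    {σ : X → ℝ} {γ : X → ℝ → ℂ} {x₀ : X} (hσ : ContinuousAt σ x₀)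
    (hγ : Continuous fun p : X × ℝ => γ p.1 p.2)
    (hγ' : Continuous fun p : X × ℝ => deriv (γ p.1) p.2) (h0 : ∀ t, γ x₀ t ≠ 0) :
    ContinuousAt (fun x => gaussianFlux (σ x) (γ x)) x₀ := by
  have hglue : Continuous expNegInvGlue := expNegInvGlue.contDiff.continuous (n := 0)
  refine continuousAt_intervalIntegral (fun x => ?_) fun t => ?_
  · have hγx : Continuous (γ x) := hγ.comp (Continuous.prodMk_right x)
    have : Continuous (deriv (γ x)) := hγ'.comp (Continuous.prodMk_right x)
    refine Measurable.aestronglyMeasurable ?_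
    simp only [logDeriv_apply]
    fun_prop
  · simp only [logDeriv_apply]
    have hσ' : ContinuousAt (fun p : X × ℝ => σ p.1) (x₀, t) := hσ.comp continuousAt_fst
    have hs : ContinuousAt (fun p : X × ℝ => expNegInvGlue (σ p.1 / ‖γ p.1 p.2‖ ^ 2)) (x₀, t) :=
      hglue.continuousAt.comp (hσ'.div (hγ.norm.pow 2).continuousAt (by simpa using h0 t))
    have hlog : ContinuousAt (fun p : X × ℝ => deriv (γ p.1) p.2 / γ p.1 p.2) (x₀, t) :=
      hγ'.continuousAt.div hγ.continuousAt (h0 t)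
    fun_prop

/-! ### Winding numbers -/

section Loop

variable {γ : ℝ → ℂ}

theorem continuous_logDeriv (hγ : ContDiff ℝ 1 γ) (h0 : ∀ t, γ t ≠ 0) :
    Continuous (logDeriv γ) :=
  (hγ.continuous_deriv le_rfl).div hγ.continuous h0

theorem eq_mul_exp_integral_logDeriv (hγ : ContDiff ℝ 1 γ) (h0 : ∀ t, γ t ≠ 0) (a t : ℝ) :
    γ t = γ a * exp (∫ s in a..t, logDeriv γ s) := by
  have hlog := continuous_logDeriv hγ h0
  have hderiv (t : ℝ) : HasDerivAt (fun t => γ t * exp (-∫ s in a..t, logDeriv γ s)) 0 t := by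
    have hγt := (hγ.differentiable one_ne_zero t).hasDerivAt
    refine (hγt.mul (hlog.integral_hasStrictDerivAt a t).hasDerivAt.neg.cexp).congr_deriv ?_
    rw [logDeriv_apply]
    field_simp [h0 t]
    ring
  have hconst : γ t * exp (-∫ s in a..t, logDeriv γ s) = γ a := by
    simpa using is_const_of_deriv_eq_zero (fun t => (hderiv t).differentiableAt)
      (fun t => (hderiv t).deriv) t a
  rw [← hconst, mul_assoc, ← exp_add, neg_add_cancel, exp_zero, mul_one]

theorem exists_int_integral_logDeriv_eq (hγ : ContDiff ℝ 1 γ) (h0 : ∀ t, γ t ≠ 0) {a b : ℝ}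
    (hab : γ a = γ b) : ∃ n : ℤ, ∫ t in a..b, logDeriv γ t = n * (2 * Real.pi * I) := by
  refine exp_eq_one_iff.1 (mul_left_cancel₀ (h0 a) ?_)
  rw [← eq_mul_exp_integral_logDeriv hγ h0, mul_one, hab]

theorem hasWindingNumber_of_integral_logDeriv_eq (hγ : ContDiff ℝ 1 γ) (h0 : ∀ t, γ t ≠ 0) {n : ℤ}
    (hn : ∫ t in (0 : ℝ)..(2 * Real.pi), logDeriv γ t = n * (2 * Real.pi * I)) :
    HasWindingNumber (fun t => γ t / ‖γ t‖) n := by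
  let Λ (t : ℝ) : ℂ := ∫ s in (0 : ℝ)..t, logDeriv γ s
  have hΛ : Continuous Λ := intervalIntegral.continuous_primitive
    (fun a b => (continuous_logDeriv hγ h0).intervalIntegrable a b) 0
  refine ⟨fun t => arg (γ 0) + (Λ t).im, by fun_prop, fun t => ?_, ?_⟩
  · have hnorm : ‖γ t‖ = ‖γ 0‖ * Real.exp (Λ t).re := by
      rw [eq_mul_exp_integral_logDeriv hγ h0 0 t, norm_mul, norm_exp]
    have hpolar : γ t = ‖γ t‖ * exp ((arg (γ 0) + (Λ t).im : ℝ) * I) :=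
      calc γ t = ‖γ 0‖ * exp (arg (γ 0) * I) * exp ((Λ t).re + (Λ t).im * I) := by
            rw [norm_mul_exp_arg_mul_I, re_add_im, ← eq_mul_exp_integral_logDeriv hγ h0]
        _ = ‖γ t‖ * exp ((arg (γ 0) + (Λ t).im : ℝ) * I) := by
            rw [hnorm, exp_add]
            push_cast
            rw [add_mul, exp_add]
            ring
    exact (div_eq_iff (by simpa using h0 t)).2 (hpolar.trans (mul_comm _ _))
  · simp [Λ, hn]
    ring

theorem integral_logDeriv_eq_of_periodic (hper : Function.Periodic γ (2 * Real.pi)) :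
    ∫ t in (-Real.pi)..Real.pi, logDeriv γ t = ∫ t in (0 : ℝ)..(2 * Real.pi), logDeriv γ t := by
  have hper' : Function.Periodic (logDeriv γ) (2 * Real.pi) := fun t => by
    rw [logDeriv_apply, logDeriv_apply, hper t, ← deriv_comp_add_const, funext hper]
  have := hper'.intervalIntegral_add_eq (-Real.pi) 0
  rwa [zero_add, show -Real.pi + 2 * Real.pi = Real.pi by ring] at this

theorem exists_hasWindingNumber (hγ : ContDiff ℝ 1 γ) (h0 : ∀ t, γ t ≠ 0)
    (hper : Function.Periodic γ (2 * Real.pi)) :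
    ∃ n : ℤ, gaussianFlux 0 γ = Real.pi * n ∧ HasWindingNumber (fun t => γ t / ‖γ t‖) n := by
  obtain ⟨n, hn⟩ := exists_int_integral_logDeriv_eq hγ h0 (a := 0) (b := 2 * Real.pi)
    (by simpa using (hper 0).symm)
  refine ⟨n, ?_, hasWindingNumber_of_integral_logDeriv_eq hγ h0 hn⟩
  have him : ∫ t in (-Real.pi)..Real.pi, (logDeriv γ t).im = 2 * Real.pi * n :=
    calc ∫ t in (-Real.pi)..Real.pi, (logDeriv γ t).im
        = (∫ t in (-Real.pi)..Real.pi, logDeriv γ t).im := imCLM.intervalIntegral_comp_comm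
          ((continuous_logDeriv hγ h0).intervalIntegrable (μ := volume) _ _)
      _ = (n * (2 * Real.pi * I)).im := by rw [integral_logDeriv_eq_of_periodic hper, hn]
      _ = 2 * Real.pi * n := by simp [mul_comm]
  rw [gaussianFlux_zero, him]
  ring

end Loop

theorem continuous_circleMap_uncurry (c : ℂ) : Continuous fun p : ℝ × ℝ => circleMap c p.1 p.2 := by
  unfold circleMap
  fun_prop

theorem continuousAt_gaussianFlux_circleMap {H : ℂ × ℂ → ℂ} (hH : ContDiff ℝ 1 H) {c : ℂ} {r₀ : ℝ}
    (h0 : ∀ t, H (circleMap c r₀ t, 0) ≠ 0) :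
    ContinuousAt (fun q : ℝ × ℝ × ℂ => gaussianFlux q.1 fun t => H (circleMap c q.2.1 t, q.2.2))
      (0, r₀, 0) := by
  have hcircle (c : ℂ) : Continuous fun p : (ℝ × ℝ × ℂ) × ℝ => circleMap c p.1.2.1 p.2 :=
    (continuous_circleMap_uncurry c).comp (by fun_prop :
      Continuous fun p : (ℝ × ℝ × ℂ) × ℝ => (p.1.2.1, p.2))
  have hderiv (r : ℝ) (b : ℂ) (t : ℝ) : deriv (fun t => H (circleMap c r t, b)) t =
      fderiv ℝ H (circleMap c r t, b) (circleMap 0 r t * I, 0) :=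
    ((hH.differentiable one_ne_zero _).hasFDerivAt.comp_hasDerivAt t
      ((hasDerivAt_circleMap c r t).prodMk (hasDerivAt_const t b))).deriv
  refine continuousAt_gaussianFlux continuousAt_fst
    (hH.continuous.comp ((hcircle c).prodMk (by fun_prop))) ?_ h0
  simp only [hderiv]
  exact ((hH.continuous_fderiv one_ne_zero).comp ((hcircle c).prodMk (by fun_prop))).clm_apply
    (((hcircle 0).mul continuous_const).prodMk continuous_const)

theorem exists_forall_hasWindingNumber {f : ℂ → ℂ} (hf : ContDiff ℝ 1 f) {c : ℂ} {S : Set ℝ}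
    (hS : IsPreconnected S) (h0 : ∀ r ∈ S, ∀ t, f (circleMap c r t) ≠ 0) :
    ∃ n : ℤ, ∀ r ∈ S, gaussianFlux 0 (fun t => f (circleMap c r t)) = Real.pi * n ∧
      HasWindingNumber (fun t => f (circleMap c r t) / ‖f (circleMap c r t)‖) n := by
  have hex (r : S) : ∃ n : ℤ, gaussianFlux 0 (fun t => f (circleMap c r t)) = Real.pi * n ∧
      HasWindingNumber (fun t => f (circleMap c r t) / ‖f (circleMap c r t)‖) n :=
    exists_hasWindingNumber (hf.comp (contDiff_circleMap c r)) (h0 r r.2)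
      ((periodic_circleMap c r).comp f)
  choose n hn using hex
  have hcont : Continuous n := by
    rw [Int.isClosedEmbedding_coe_real.isInducing.continuous_iff]
    have hflux : Continuous fun r : S => gaussianFlux 0 (fun t => f (circleMap c r t)) :=
      continuous_iff_continuousAt.2 fun r =>
        (continuousAt_gaussianFlux_circleMap (H := fun p => f p.1) (hf.comp contDiff_fst)
          (h0 r r.2)).comp (f := fun r : S => ((0 : ℝ), (r : ℝ), (0 : ℂ))) (by fun_prop)
    refine (hflux.div_const Real.pi).congr fun r => ?_
    rw [(hn r).1, mul_div_cancel_left₀ _ Real.pi_ne_zero]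
    rfl
  have := isPreconnected_iff_preconnectedSpace.1 hS
  obtain hempty | ⟨⟨r₀⟩⟩ := isEmpty_or_nonempty S
  · exact ⟨0, fun r hr => (hempty.false ⟨r, hr⟩).elim⟩
  · refine ⟨n r₀, fun r hr => ?_⟩
    rw [PreconnectedSpace.constant ‹_› hcont (x := r₀) (y := ⟨r, hr⟩)]
    exact hn ⟨r, hr⟩

/-! ### Homogeneous extensions and the mapping degree -/

section RadialExtension

variable {E F : Type*} [NormedAddCommGroup E] [NormedAddCommGroup F] [NormedSpace ℝ F]

theorem fderiv_apply_self_of_homogeneous [NormedSpace ℝ E] {f : E → F} {u : E} {k : ℕ}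
    (hf : DifferentiableAt ℝ f u) (hom : ∀ r : ℝ, 0 < r → f (r • u) = r ^ k • f u) :
    fderiv ℝ f u u = (k : ℝ) • f u := by
  have hline : HasDerivAt (fun r : ℝ => r • u) u 1 := by
    simpa using (hasDerivAt_id (1 : ℝ)).smul_const u
  have hchain : HasDerivAt (f ∘ fun r : ℝ => r • u) (fderiv ℝ f u u) 1 :=
    HasFDerivAt.comp_hasDerivAt 1 (by simpa using hf.hasFDerivAt) hline
  have hpow : HasDerivAt (fun r : ℝ => r ^ k • f u) ((k : ℝ) • f u) 1 := by
    simpa using (hasDerivAt_pow k (1 : ℝ)).smul_const (f u)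
  refine hchain.unique (hpow.congr_of_eventuallyEq ?_)
  filter_upwards [lt_mem_nhds one_pos] with r hr using hom r hr

theorem det_fderiv_smul_of_apply_self [NormedSpace ℝ E] [FiniteDimensional ℝ E]
    {N : E → ℝ} {Θ : E → E} {u : E} (hN : DifferentiableAt ℝ N u)
    (hΘ : DifferentiableAt ℝ Θ u) (hN0 : N u ≠ 0) (hNu : fderiv ℝ N u u = 0)
    (hΘu : fderiv ℝ Θ u u = Θ u) :
    (fderiv ℝ (fun x => N x • Θ x) u).det = N u ^ Module.finrank ℝ E * (fderiv ℝ Θ u).det := by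
  have hfactor : (fderiv ℝ (fun x => N x • Θ x) u : E →ₗ[ℝ] E) = N u • (fderiv ℝ Θ u : E →ₗ[ℝ] E) ∘ₗ
      LinearMap.transvection ((N u)⁻¹ • (fderiv ℝ N u : E →ₗ[ℝ] ℝ)) u := by
    ext v
    simp [fderiv_fun_smul hN hΘ, LinearMap.transvection.apply, hΘu, smul_smul, hN0]
  rw [ContinuousLinearMap.det, hfactor, LinearMap.det_smul, LinearMap.det_comp,
    LinearMap.transvection.det]
  simp [hNu, ContinuousLinearMap.det]

section NormedSpace

variable [NormedSpace ℝ E]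

/-- The positively homogeneous map of degree one that agrees with `Φ` on the unit sphere. -/
noncomputable def radialExtension (Φ : E → F) (x : E) : F := ‖x‖ • Φ (NormedSpace.normalize x)

variable {Φ : E → F}

theorem radialExtension_smul (Φ : E → F) (x : E) {r : ℝ} (hr : 0 < r) :
    radialExtension Φ (r • x) = r • radialExtension Φ x := by
  rw [radialExtension, NormedSpace.normalize_smul_of_pos hr, norm_smul, Real.norm_of_nonneg hr.le,
    radialExtension, smul_smul]

theorem radialExtension_of_norm_eq_one (Φ : E → F) {x : E} (hx : ‖x‖ = 1) :
    radialExtension Φ x = Φ x := by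
  rw [radialExtension, hx, one_smul, NormedSpace.normalize_eq_self_of_norm_eq_one hx]

theorem fderiv_radialExtension_smul (Φ : E → F) (x : E) {r : ℝ} (hr : 0 < r) :
    fderiv ℝ (radialExtension Φ) (r • x) = fderiv ℝ (radialExtension Φ) x := by
  refine smul_right_injective _ hr.ne' (?_ : r • _ = r • _)
  rw [← fderiv_comp_smul, funext fun v => radialExtension_smul Φ v hr]
  exact congrFun (fderiv_const_smul_field r) x

theorem radialExtension_eq_norm_smul (Φ : E → F) :
    radialExtension Φ = fun x => ‖Φ (NormedSpace.normalize x)‖ •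
      radialExtension (fun y => NormedSpace.normalize (Φ y)) x := by
  ext x
  simp only [radialExtension]
  rw [smul_comm, NormedSpace.norm_smul_normalize]

theorem exists_pos_forall_mul_norm_le_norm_radialExtension [FiniteDimensional ℝ E]
    (hΦ : Continuous Φ) (h0 : ∀ x, ‖x‖ = 1 → Φ x ≠ 0) :
    ∃ c > 0, ∀ x, c * ‖x‖ ≤ ‖radialExtension Φ x‖ := by
  obtain ⟨c, hc, hle⟩ := (isCompact_sphere (0 : E) 1).exists_forall_le' (a := 0)
    hΦ.norm.continuousOn fun x hx => norm_pos_iff.2 (h0 x (by simpa using hx))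
  refine ⟨c, hc, fun x => ?_⟩
  rcases eq_or_ne x 0 with rfl | hx
  · simp
  · rw [radialExtension, norm_smul, norm_norm, mul_comm]
    gcongr
    exact hle _ (by simpa using hx)

end NormedSpace

section InnerProductSpace

variable [InnerProductSpace ℝ E]

theorem hasFDerivAt_norm_of_norm_eq_one {u : E} (hu : ‖u‖ = 1) :
    HasFDerivAt (‖·‖) (innerSL ℝ u) u := by
  have hsqrt := (hasStrictFDerivAt_norm_sq u).hasFDerivAt.sqrt (by rw [hu]; norm_num)
  simp only [Real.sqrt_sq (norm_nonneg _), hu] at hsqrt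
  refine hsqrt.congr_fderiv ?_
  ext v
  simp

theorem contDiffAt_normalize {u : E} (hu : u ≠ 0) {n : WithTop ℕ∞} :
    ContDiffAt ℝ n (NormedSpace.normalize : E → E) u :=
  ((contDiffAt_norm ℝ hu).inv (norm_ne_zero_iff.2 hu)).smul contDiffAt_id

theorem differentiableAt_comp_normalize {Φ : E → F} {x : E}
    (hΦ : DifferentiableAt ℝ Φ (NormedSpace.normalize x)) (hx : x ≠ 0) :
    DifferentiableAt ℝ (fun y => Φ (NormedSpace.normalize y)) x :=
  hΦ.comp x ((contDiffAt_normalize hx (n := 1)).differentiableAt one_ne_zero)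

theorem differentiableAt_radialExtension {Φ : E → F} {x : E}
    (hΦ : DifferentiableAt ℝ Φ (NormedSpace.normalize x)) (hx : x ≠ 0) :
    DifferentiableAt ℝ (radialExtension Φ) x :=
  (differentiableAt_id.norm ℝ hx).smul (differentiableAt_comp_normalize hΦ hx)

theorem contDiffAt_radialExtension {Φ : E → F} {n : WithTop ℕ∞} {x : E}
    (hΦ : ContDiffAt ℝ n Φ (NormedSpace.normalize x)) (hx : x ≠ 0) :
    ContDiffAt ℝ n (radialExtension Φ) x :=
  (contDiffAt_norm ℝ hx).smul (hΦ.comp x (contDiffAt_normalize hx))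

theorem exists_abs_det_fderiv_radialExtension_le [FiniteDimensional ℝ E] {Φ : E → E}
    (hΦ : ContDiff ℝ 1 Φ) : ∃ C, ∀ x ≠ 0, |(fderiv ℝ (radialExtension Φ) x).det| ≤ C := by
  have hcont : ContinuousOn (fun x => (fderiv ℝ (radialExtension Φ) x).det) {0}ᶜ :=
    ContinuousLinearMap.continuous_det.comp_continuousOn (ContDiffOn.continuousOn_fderiv_of_isOpen
      (fun x hx => (contDiffAt_radialExtension hΦ.contDiffAt hx).contDiffWithinAt)
      isOpen_compl_singleton le_rfl)
  obtain ⟨C, hC⟩ := (isCompact_sphere (0 : E) 1).exists_bound_of_continuousOn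
    (hcont.mono fun x hx => by rintro rfl; simp at hx)
  refine ⟨C, fun x hx => ?_⟩
  rw [← fderiv_radialExtension_smul Φ x (inv_pos.2 (norm_pos_iff.2 hx))]
  exact hC (NormedSpace.normalize x) (by simpa using hx)

end InnerProductSpace

end RadialExtension

section SphereJacobian

variable {m : ℕ} {Φ : EuclideanSpace ℝ (Fin m) → EuclideanSpace ℝ (Fin m)}
  {u : EuclideanSpace ℝ (Fin m)}

theorem sphereJacobian_eq_det_fderiv_radialExtension (hu : ‖u‖ = 1)
    (hΦ : DifferentiableAt ℝ Φ u) :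
    sphereJacobian Φ u = (fderiv ℝ (radialExtension Φ) u).det := by
  have hune : u ≠ 0 := norm_ne_zero_iff.1 (hu ▸ one_ne_zero)
  have hn : NormedSpace.normalize u = u := NormedSpace.normalize_eq_self_of_norm_eq_one hu
  have hcomp := differentiableAt_comp_normalize (by rwa [hn]) hune
  have hfderiv := ((hasFDerivAt_norm_of_norm_eq_one hu).smul hcomp.hasFDerivAt).fderiv
  rw [hn, hu, one_smul] at hfderiv
  exact congrArg ContinuousLinearMap.det hfderiv.symm

theorem det_fderiv_radialExtension (hu : ‖u‖ = 1) (hΦ : DifferentiableAt ℝ Φ u) (h0 : Φ u ≠ 0) :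
    (fderiv ℝ (radialExtension Φ) u).det =
      ‖Φ u‖ ^ m * sphereJacobian (fun x => ‖Φ x‖⁻¹ • Φ x) u := by
  have hune : u ≠ 0 := norm_ne_zero_iff.1 (hu ▸ one_ne_zero)
  have hn : NormedSpace.normalize u = u := NormedSpace.normalize_eq_self_of_norm_eq_one hu
  have hnorm : DifferentiableAt ℝ (fun x => ‖Φ (NormedSpace.normalize x)‖) u :=
    (differentiableAt_comp_normalize (by rwa [hn]) hune).norm ℝ (by rwa [hn])
  have hdir : DifferentiableAt ℝ (fun x => NormedSpace.normalize (Φ x)) u :=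
    ((contDiffAt_normalize h0 (n := 1)).differentiableAt one_ne_zero).comp u hΦ
  have hext : DifferentiableAt ℝ (radialExtension fun x => NormedSpace.normalize (Φ x)) u :=
    differentiableAt_radialExtension (by rwa [hn]) hune
  rw [radialExtension_eq_norm_smul, det_fderiv_smul_of_apply_self hnorm hext
    (by simpa [hn] using h0) ?_ ?_, hn, finrank_euclideanSpace_fin,
    ← sphereJacobian_eq_det_fderiv_radialExtension hu hdir]
  · rfl
  · simpa using fderiv_apply_self_of_homogeneous (k := 0) hnorm fun r hr => by
      rw [NormedSpace.normalize_smul_of_pos hr, pow_zero, one_smul]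
  · simpa using fderiv_apply_self_of_homogeneous (k := 1) hext fun r hr => by
      rw [radialExtension_smul _ _ hr, pow_one]

end SphereJacobian

theorem integral_eq_integral_sphere_integral_Ioi {E F : Type*} [NormedAddCommGroup E]
    [NormedSpace ℝ E] [MeasurableSpace E] [BorelSpace E] [FiniteDimensional ℝ E] [Nontrivial E]
    [NormedAddCommGroup F] [NormedSpace ℝ F]
    (μ : Measure E) [μ.IsAddHaarMeasure] {f : E → F} (hf : Integrable f μ) :
    ∫ x, f x ∂μ = ∫ s, ∫ r in Ioi (0 : ℝ), r ^ (Module.finrank ℝ E - 1) • f (r • (s : E))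
      ∂volume ∂μ.toSphere := by
  let n := Module.finrank ℝ E - 1
  let w (p : Metric.sphere (0 : E) 1 × Ioi (0 : ℝ)) : F := f (p.2.1 • p.1.1)
  have hmp := μ.measurePreserving_homeomorphUnitSphereProd
  have hemb := (homeomorphUnitSphereProd E).measurableEmbedding
  have hw (x : ({0}ᶜ : Set E)) : w (homeomorphUnitSphereProd E x) = f x :=
    congrArg (fun y : ({0}ᶜ : Set E) => f y) ((homeomorphUnitSphereProd E).symm_apply_apply x)
  have hw_int : Integrable w (μ.toSphere.prod (Measure.volumeIoiPow n)) := by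
    rw [← hmp.integrable_comp_emb hemb, Function.comp_def, funext hw]
    exact (integrableOn_iff_comap_subtypeVal (by measurability)).1 hf.integrableOn
  calc ∫ x, f x ∂μ = ∫ x : ({0}ᶜ : Set E), f x ∂(μ.comap (↑)) := by
        rw [integral_subtype_comap (measurableSet_singleton _).compl f, restrict_compl_singleton]
    _ = ∫ p, w p ∂(μ.toSphere.prod (Measure.volumeIoiPow n)) := by
        rw [← hmp.integral_comp hemb, funext hw]
    _ = ∫ s, ∫ r, w (s, r) ∂Measure.volumeIoiPow n ∂μ.toSphere := integral_prod _ hw_int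
    _ = _ := by
        refine integral_congr_ae (ae_of_all _ fun s => ?_)
        simp only [Measure.volumeIoiPow, ENNReal.ofReal, w]
        rw [integral_withDensity_eq_integral_smul (by fun_prop),
          integral_subtype_comap measurableSet_Ioi fun r : ℝ => (r ^ n).toNNReal • f (r • (s : E))]
        refine setIntegral_congr_fun measurableSet_Ioi fun r hr => ?_
        rw [NNReal.smul_def, Real.coe_toNNReal _ (pow_nonneg (le_of_lt hr) _)]

theorem integrable_exp_neg_mul_sq_norm {E : Type*} [NormedAddCommGroup E] [InnerProductSpace ℝ E]
    [FiniteDimensional ℝ E] [MeasurableSpace E] [BorelSpace E] {b : ℝ} (hb : 0 < b) :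
    Integrable fun x : E => Real.exp (-b * ‖x‖ ^ 2) := by
  have hgauss :=
    (GaussianFourier.integrable_cexp_neg_mul_sq_norm_add (b := b) (by simpa) 0 (0 : E)).re
  refine hgauss.congr (ae_of_all _ fun x => ?_)
  simp [← exp_ofReal_re]

theorem integrable_gaussian_mul_det_fderiv_radialExtension {E : Type*} [NormedAddCommGroup E]
    [InnerProductSpace ℝ E] [FiniteDimensional ℝ E] [Nontrivial E] [MeasurableSpace E]
    [BorelSpace E] {Φ : E → E} (hΦ : ContDiff ℝ 1 Φ) (h0 : ∀ x, ‖x‖ = 1 → Φ x ≠ 0) :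
    Integrable fun x =>
      Real.exp (-‖radialExtension Φ x‖ ^ 2) * (fderiv ℝ (radialExtension Φ) x).det := by
  obtain ⟨c, hc, hcle⟩ := exists_pos_forall_mul_norm_le_norm_radialExtension hΦ.continuous h0
  obtain ⟨C, hC⟩ := exists_abs_det_fderiv_radialExtension_le hΦ
  have hm : Measurable (radialExtension Φ) := by
    have := hΦ.continuous.measurable
    unfold radialExtension NormedSpace.normalize
    fun_prop
  have hm' : Measurable fun x => (fderiv ℝ (radialExtension Φ) x).det :=
    ContinuousLinearMap.continuous_det.measurable.comp (measurable_fderiv ℝ _)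
  refine ((integrable_exp_neg_mul_sq_norm (b := c ^ 2) (by positivity)).mul_const C).mono'
    (by fun_prop) ?_
  have hne : ∀ᵐ x : E, x ≠ 0 := Measure.ae_ne volume 0
  filter_upwards [hne] with x hx
  rw [norm_mul, Real.norm_of_nonneg (Real.exp_nonneg _), Real.norm_eq_abs]
  have hsq : (c * ‖x‖) ^ 2 ≤ ‖radialExtension Φ x‖ ^ 2 := by gcongr; exact hcle x
  refine mul_le_mul ?_ (hC x hx) (abs_nonneg _) (Real.exp_nonneg _)
  gcongr
  linarith

section MappingDegree

variable {m : ℕ} [NeZero m] {Φ : EuclideanSpace ℝ (Fin m) → EuclideanSpace ℝ (Fin m)}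

theorem integral_Ioi_gaussian_mul_det_fderiv_radialExtension {u : EuclideanSpace ℝ (Fin m)}
    (hu : ‖u‖ = 1) (hΦ : DifferentiableAt ℝ Φ u) (h0 : Φ u ≠ 0) :
    ∫ r in Ioi (0 : ℝ), r ^ (m - 1) * (Real.exp (-‖radialExtension Φ (r • u)‖ ^ 2) *
        (fderiv ℝ (radialExtension Φ) (r • u)).det) =
      sphereJacobian (fun x => ‖Φ x‖⁻¹ • Φ x) u *
        ∫ r in Ioi (0 : ℝ), r ^ (m - 1) * Real.exp (-r ^ 2) := by
  have hpos : 0 < ‖Φ u‖ := norm_pos_iff.2 h0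
  have hscale := integral_comp_mul_left_Ioi
    (fun r : ℝ => r ^ (m - 1) * Real.exp (-r ^ 2)) 0 hpos
  rw [mul_zero, smul_eq_mul, eq_inv_mul_iff_mul_eq₀ hpos.ne'] at hscale
  rw [← hscale, ← integral_const_mul, ← integral_const_mul]
  refine setIntegral_congr_fun measurableSet_Ioi fun r (hr : 0 < r) => ?_
  simp only [radialExtension_smul _ _ hr, fderiv_radialExtension_smul _ _ hr,
    det_fderiv_radialExtension hu hΦ h0, radialExtension_of_norm_eq_one _ hu, norm_smul,
    Real.norm_of_nonneg hr.le]
  rw [← mul_pow_sub_one (NeZero.ne m) ‖Φ u‖]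
  ring_nf

theorem integral_gaussian_mul_det_fderiv_radialExtension (hΦ : ContDiff ℝ 1 Φ)
    (h0 : ∀ x, ‖x‖ = 1 → Φ x ≠ 0) :
    ∫ x, Real.exp (-‖radialExtension Φ x‖ ^ 2) * (fderiv ℝ (radialExtension Φ) x).det =
      mappingDegree (fun x => ‖Φ x‖⁻¹ • Φ x) *
        ∫ x : EuclideanSpace ℝ (Fin m), Real.exp (-‖x‖ ^ 2) := by
  rw [integral_eq_integral_sphere_integral_Ioi volume
    (integrable_gaussian_mul_det_fderiv_radialExtension hΦ h0),
    integral_fun_norm_addHaar volume fun r => Real.exp (-r ^ 2), ← smul_assoc, nsmul_eq_mul,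
    ← Measure.toSphere_real_apply_univ, mappingDegree, average_eq]
  have hsphere (s : Metric.sphere (0 : EuclideanSpace ℝ (Fin m)) 1) :=
    integral_Ioi_gaussian_mul_det_fderiv_radialExtension (u := s) (by simp)
      (hΦ.differentiable one_ne_zero _) (h0 s (by simp))
  have : NeZero (volume : Measure (EuclideanSpace ℝ (Fin m))).toSphere :=
    ⟨Measure.toSphere_ne_zero _⟩
  have hvol := measureReal_univ_ne_zero
    (μ := (volume : Measure (EuclideanSpace ℝ (Fin m))).toSphere)
  simp only [finrank_euclideanSpace_fin, smul_eq_mul, hsphere, integral_mul_const]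
  field_simp

end MappingDegree

/-! ### Maps fibered over the second coordinate -/

theorem det_eq_det_fst_comp_inl {R V W : Type*} [CommRing R] [AddCommGroup V] [Module R V]
    [AddCommGroup W] [Module R W] [Module.Free R V] [Module.Finite R V] [Module.Free R W]
    [Module.Finite R W] {A : V × W →ₗ[R] V × W}
    (hA : LinearMap.snd R V W ∘ₗ A = LinearMap.snd R V W) :
    LinearMap.det A = LinearMap.det (LinearMap.fst R V W ∘ₗ A ∘ₗ LinearMap.inl R V W) := by
  classical
  let v := Module.Free.chooseBasis R V
  let w := Module.Free.chooseBasis R W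
  have hsnd (p : V × W) : (A p).2 = p.2 := LinearMap.congr_fun hA p
  have hblock : LinearMap.toMatrix (v.prod w) (v.prod w) A =
      Matrix.fromBlocks (LinearMap.toMatrix v v (LinearMap.fst R V W ∘ₗ A ∘ₗ LinearMap.inl R V W))
        (LinearMap.toMatrix w v (LinearMap.fst R V W ∘ₗ A ∘ₗ LinearMap.inr R V W)) 0 1 := by
    ext (i | i) (j | j) <;>
      simp [LinearMap.toMatrix_apply, hsnd, Matrix.one_apply, Finsupp.single_apply, eq_comm]
  rw [← LinearMap.det_toMatrix (v.prod w), hblock, Matrix.det_fromBlocks_zero₂₁, Matrix.det_one,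
    mul_one, LinearMap.det_toMatrix]

theorem det_fderiv_eq_of_snd_eq {V W : Type*} [NormedAddCommGroup V] [NormedSpace ℝ V]
    [NormedAddCommGroup W] [NormedSpace ℝ W] [FiniteDimensional ℝ V] [FiniteDimensional ℝ W]
    {T : V × W → V × W} (hT : ∀ p, (T p).2 = p.2) {p : V × W} (hd : DifferentiableAt ℝ T p) :
    (fderiv ℝ T p).det = (fderiv ℝ (fun v => (T (v, p.2)).1) p.1).det := by
  have hsnd : (ContinuousLinearMap.snd ℝ V W).comp (fderiv ℝ T p) = .snd ℝ V W :=
    hd.hasFDerivAt.snd.unique (hasFDerivAt_snd.congr_of_eventuallyEq (.of_forall hT))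
  have hfst : HasFDerivAt (fun v => (T (v, p.2)).1)
      ((ContinuousLinearMap.fst ℝ V W).comp ((fderiv ℝ T p).comp (.inl ℝ V W))) p.1 :=
    (hd.hasFDerivAt.comp p.1 (hasFDerivAt_prodMk_left p.1 p.2)).fst
  rw [hfst.fderiv]
  exact det_eq_det_fst_comp_inl (congrArg ContinuousLinearMap.toLinearMap hsnd)

theorem det_fderiv_conj {E F : Type*} [NormedAddCommGroup E] [NormedSpace ℝ E]
    [NormedAddCommGroup F] [NormedSpace ℝ F] (e : E ≃L[ℝ] F) (T : F → F) (p : E) :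
    (fderiv ℝ (fun q => e.symm (T (e q))) p).det = (fderiv ℝ T (e p)).det := by
  have h : fderiv ℝ (fun q => e.symm (T (e q))) p =
      (e.symm : F →L[ℝ] E).comp ((fderiv ℝ T (e p)).comp (e : E →L[ℝ] F)) := by
    rw [← e.comp_right_fderiv]
    exact e.symm.comp_fderiv
  rw [h]
  exact LinearMap.det_conj _ e.symm.toLinearEquiv

/-- The identification `ℂ² ≃ ℝ⁴` of `toRealSpace` and `toComplexPlane`, as a real linear
equivalence. -/
noncomputable def planeEquiv : (ℂ × ℂ) ≃L[ℝ] EuclideanSpace ℝ (Fin 4) :=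
  LinearEquiv.toContinuousLinearEquiv
    { toFun := fun p => toRealSpace ![p.1, p.2]
      invFun := fun x => (toComplexPlane x 0, toComplexPlane x 1)
      map_add' := fun p q => by ext i; fin_cases i <;> simp [toRealSpace]
      map_smul' := fun r p => by ext i; fin_cases i <;> simp [toRealSpace]
      left_inv := fun p => by ext <;> simp [toRealSpace, toComplexPlane]
      right_inv := fun x => by ext i; fin_cases i <;> simp [toRealSpace, toComplexPlane] }

theorem norm_sq_planeEquiv (p : ℂ × ℂ) : ‖planeEquiv p‖ ^ 2 = ‖p.1‖ ^ 2 + ‖p.2‖ ^ 2 := by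
  rw [EuclideanSpace.norm_sq_eq, ← normSq_eq_norm_sq, ← normSq_eq_norm_sq]
  simp [planeEquiv, toRealSpace, Fin.sum_univ_four, normSq_apply]
  ring

theorem measurePreserving_planeEquiv : MeasurePreserving (planeEquiv : ℂ × ℂ → _) := by
  let e : WithLp 2 (ℂ × ℂ) ≃ₗᵢ[ℝ] EuclideanSpace ℝ (Fin 4) :=
    { toLinearEquiv := (WithLp.linearEquiv 2 ℝ (ℂ × ℂ)).trans planeEquiv.toLinearEquiv
      norm_map' := fun w => by
        rw [← sq_eq_sq₀ (norm_nonneg _) (norm_nonneg _), WithLp.prod_norm_sq_eq_of_L2]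
        exact norm_sq_planeEquiv w.ofLp }
  exact e.measurePreserving.comp (WithLp.volume_preserving_toLp ℂ ℂ)

theorem integrable_comp_planeEquiv {f : EuclideanSpace ℝ (Fin 4) → ℝ} (hf : Integrable f) :
    Integrable fun p => f (planeEquiv p) :=
  (measurePreserving_planeEquiv.integrable_comp_emb
    planeEquiv.toHomeomorph.measurableEmbedding).2 hf

theorem integral_eq_integral_integral_planeEquiv {f : EuclideanSpace ℝ (Fin 4) → ℝ}
    (hf : Integrable f) : ∫ x, f x = ∫ b : ℂ, ∫ z : ℂ, f (planeEquiv (z, b)) := by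
  rw [← measurePreserving_planeEquiv.integral_comp
    planeEquiv.toHomeomorph.measurableEmbedding, Measure.volume_eq_prod,
    integral_prod_symm _ (integrable_comp_planeEquiv hf)]

theorem tendsto_sqrt_sq_add_atTop {c : ℝ} (hc : 0 ≤ c) :
    Tendsto (fun R : ℝ => √(R ^ 2 + c)) atTop atTop :=
  tendsto_atTop_mono (fun _ => Real.le_sqrt_of_sq_le (le_add_of_nonneg_right hc)) tendsto_id

theorem tendsto_div_sqrt_sq_add {c : ℝ} (hc : 0 ≤ c) :
    Tendsto (fun R : ℝ => R / √(R ^ 2 + c)) atTop (𝓝 1) := by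
  have hlim : Tendsto (fun R : ℝ => (√(1 + c * (R ^ 2)⁻¹))⁻¹) atTop (𝓝 1) := by
    have hinv : Tendsto (fun R : ℝ => (R ^ 2)⁻¹) atTop (𝓝 0) :=
      (tendsto_pow_atTop two_ne_zero).inv_tendsto_atTop
    simpa using (((hinv.const_mul c).const_add 1).sqrt).inv₀ (by simp)
  refine hlim.congr' ?_
  filter_upwards [eventually_gt_atTop 0] with R hR
  rw [show R ^ 2 + c = R ^ 2 * (1 + c * (R ^ 2)⁻¹) by field_simp, Real.sqrt_mul (sq_nonneg R),
    Real.sqrt_sq hR.le, div_mul_cancel_left₀ hR.ne']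

/-- The map `(z, b) ↦ (H (z, b), b)` of `ℂ²`, in real coordinates. -/
noncomputable def fiberedMap (H : ℂ × ℂ → ℂ) (x : EuclideanSpace ℝ (Fin 4)) :
    EuclideanSpace ℝ (Fin 4) :=
  planeEquiv (H (planeEquiv.symm x), (planeEquiv.symm x).2)

/-- The first coordinate of the homogeneous extension of `fiberedMap H`, on the complex line
`z₂ = b`. -/
noncomputable def fiberMap (H : ℂ × ℂ → ℂ) (b z : ℂ) : ℂ :=
  ‖planeEquiv (z, b)‖ * H (z / ‖planeEquiv (z, b)‖, b / ‖planeEquiv (z, b)‖)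

section Fibered

variable {H : ℂ × ℂ → ℂ}

theorem contDiff_fiberedMap {n : WithTop ℕ∞} (hH : ContDiff ℝ n H) :
    ContDiff ℝ n (fiberedMap H) :=
  planeEquiv.contDiff.comp ((hH.comp planeEquiv.symm.contDiff).prodMk
    (contDiff_snd.comp planeEquiv.symm.contDiff))

theorem fiberedMap_ne_zero (h0 : ∀ t, H (circleMap 0 1 t, 0) ≠ 0) {x : EuclideanSpace ℝ (Fin 4)}
    (hx : ‖x‖ = 1) : fiberedMap H x ≠ 0 := by
  obtain ⟨⟨z, b⟩, rfl⟩ := planeEquiv.surjective x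
  rw [fiberedMap, ContinuousLinearEquiv.symm_apply_apply, map_ne_zero_iff _ planeEquiv.injective]
  intro h
  obtain ⟨hHz, rfl : b = 0⟩ := Prod.mk_eq_zero.1 h
  have hz : z ∈ Metric.sphere 0 |1| := by
    have hnorm : ‖z‖ ^ 2 = 1 := by simpa [hx] using (norm_sq_planeEquiv (z, 0)).symm
    simpa using (pow_eq_one_iff_of_nonneg (norm_nonneg z) two_ne_zero).1 hnorm
  obtain ⟨t, rfl⟩ := (range_circleMap 0 1).ge hz
  exact h0 t hHz

theorem radialExtension_fiberedMap (z b : ℂ) :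
    radialExtension (fiberedMap H) (planeEquiv (z, b)) = planeEquiv (fiberMap H b z, b) := by
  rcases eq_or_ne (z, b) 0 with h | h
  · obtain ⟨rfl, rfl⟩ := Prod.mk_eq_zero.1 h
    have h0 : planeEquiv (0, 0) = 0 := map_zero planeEquiv
    simp [radialExtension, fiberMap, h0]
  have hne : (‖planeEquiv (z, b)‖ : ℂ) ≠ 0 := by simpa using h
  rw [radialExtension, fiberedMap, NormedSpace.normalize, ← map_smul, ← map_smul]
  simp only [ContinuousLinearEquiv.symm_apply_apply, fiberMap, Prod.smul_mk, real_smul,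
    ofReal_inv, div_eq_inv_mul, mul_inv_cancel_left₀ hne]

theorem contDiff_fiberMap {n : WithTop ℕ∞} (hH : ContDiff ℝ n H) {b : ℂ} (hb : b ≠ 0) :
    ContDiff ℝ n (fiberMap H b) := by
  have hfst : fiberMap H b =
      fun z => (planeEquiv.symm (radialExtension (fiberedMap H) (planeEquiv (z, b)))).1 := by
    simp only [radialExtension_fiberedMap, ContinuousLinearEquiv.symm_apply_apply]
  rw [hfst]
  refine contDiff_fst.comp (planeEquiv.symm.contDiff.comp (contDiff_iff_contDiffAt.2 fun z => ?_))
  exact (contDiffAt_radialExtension (contDiff_fiberedMap hH).contDiffAt (by simp [hb])).comp z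
    (planeEquiv.contDiff.comp (contDiff_prodMk_left b)).contDiffAt

theorem det_fderiv_radialExtension_fiberedMap (hH : ContDiff ℝ 1 H) {b : ℂ} (hb : b ≠ 0) (z : ℂ) :
    (fderiv ℝ (radialExtension (fiberedMap H)) (planeEquiv (z, b))).det =
      (fderiv ℝ (fiberMap H b) z).det := by
  have hd : DifferentiableAt ℝ (radialExtension (fiberedMap H)) (planeEquiv (z, b)) :=
    differentiableAt_radialExtension ((contDiff_fiberedMap hH).differentiable one_ne_zero _)
      (by simp [hb])
  rw [← det_fderiv_conj, det_fderiv_eq_of_snd_eq]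
  · simp only [radialExtension_fiberedMap, ContinuousLinearEquiv.symm_apply_apply]
  · rintro ⟨z, b⟩
    simp only [radialExtension_fiberedMap, ContinuousLinearEquiv.symm_apply_apply]
  · exact planeEquiv.symm.differentiableAt.comp _ (hd.comp _ planeEquiv.differentiableAt)

theorem fiberMap_circleMap (b : ℂ) (R t : ℝ) :
    fiberMap H b (circleMap 0 R t) = (√(R ^ 2 + ‖b‖ ^ 2) : ℝ) *
      H (circleMap 0 (R / √(R ^ 2 + ‖b‖ ^ 2)) t, (√(R ^ 2 + ‖b‖ ^ 2))⁻¹ • b) := by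
  have hnorm : ‖planeEquiv (circleMap 0 R t, b)‖ = √(R ^ 2 + ‖b‖ ^ 2) := by
    rw [← Real.sqrt_sq (norm_nonneg (planeEquiv _)), norm_sq_planeEquiv]
    simp
  rw [fiberMap, hnorm]
  simp only [circleMap, zero_add, ofReal_div, div_mul_eq_mul_div, real_smul, ofReal_inv,
    div_eq_inv_mul b]

theorem tendsto_gaussianFlux_fiberMap (hH : ContDiff ℝ 1 H)
    (h0 : ∀ t, H (circleMap 0 1 t, 0) ≠ 0) {b : ℂ} (hb : b ≠ 0) :
    Tendsto (fun R => gaussianFlux 1 fun t => fiberMap H b (circleMap 0 R t)) atTop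
      (𝓝 (gaussianFlux 0 fun t => H (circleMap 0 1 t, 0))) := by
  let N : ℝ → ℝ := fun R => √(R ^ 2 + ‖b‖ ^ 2)
  have hN (R : ℝ) : (N R : ℂ) ≠ 0 :=
    ofReal_ne_zero.2 (Real.sqrt_pos.2 (by positivity)).ne'
  have hflux (R : ℝ) : gaussianFlux 1 (fun t => fiberMap H b (circleMap 0 R t)) =
      gaussianFlux ((N R)⁻¹ ^ 2) fun t => H (circleMap 0 (R / N R) t, (N R)⁻¹ • b) := by
    simp only [fiberMap_circleMap]
    rw [gaussianFlux_const_mul (hN R), norm_real, Real.norm_eq_abs, sq_abs, one_div, inv_pow]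
  have hNinv : Tendsto (fun R => (N R)⁻¹) atTop (𝓝 0) :=
    (tendsto_sqrt_sq_add_atTop (sq_nonneg _)).inv_tendsto_atTop
  have hparam : Tendsto (fun R => ((N R)⁻¹ ^ 2, R / N R, (N R)⁻¹ • b)) atTop (𝓝 (0, 1, 0)) := by
    refine Tendsto.prodMk_nhds ?_ ((tendsto_div_sqrt_sq_add (sq_nonneg _)).prodMk_nhds ?_)
    · simpa using hNinv.pow 2
    · simpa using hNinv.smul_const b
  simpa only [hflux, Function.comp_def] using
    (continuousAt_gaussianFlux_circleMap hH h0).tendsto.comp hparam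

theorem integral_gaussian_mul_det_fderiv_radialExtension_fiberedMap (hH : ContDiff ℝ 2 H)
    (h0 : ∀ t, H (circleMap 0 1 t, 0) ≠ 0) :
    ∫ x, Real.exp (-‖radialExtension (fiberedMap H) x‖ ^ 2) *
        (fderiv ℝ (radialExtension (fiberedMap H)) x).det =
      (∫ b : ℂ, Real.exp (-‖b‖ ^ 2)) * gaussianFlux 0 fun t => H (circleMap 0 1 t, 0) := by
  have hH1 : ContDiff ℝ 1 H := hH.of_le one_le_two
  have hint := integrable_gaussian_mul_det_fderiv_radialExtension (contDiff_fiberedMap hH1)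
    fun x => fiberedMap_ne_zero h0
  rw [integral_eq_integral_integral_planeEquiv hint, ← integral_mul_const]
  refine integral_congr_ae ?_
  filter_upwards [(integrable_comp_planeEquiv hint).prod_left_ae, Measure.ae_ne volume 0]
    with b hint_b hb
  have hsplit (z : ℂ) : Real.exp (-‖radialExtension (fiberedMap H) (planeEquiv (z, b))‖ ^ 2) *
        (fderiv ℝ (radialExtension (fiberedMap H)) (planeEquiv (z, b))).det =
      Real.exp (-‖b‖ ^ 2) *
        (Real.exp (-‖fiberMap H b z‖ ^ 2) * (fderiv ℝ (fiberMap H b) z).det) := by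
    rw [det_fderiv_radialExtension_fiberedMap hH1 hb, radialExtension_fiberedMap,
      norm_sq_planeEquiv, neg_add_rev, Real.exp_add, mul_assoc]
  simp only [hsplit] at hint_b ⊢
  rw [integral_const_mul, integral_gaussian_mul_det_eq_of_tendsto (contDiff_fiberMap hH hb)
    ((integrable_const_mul_iff (Real.exp_ne_zero _).isUnit _).1 hint_b)
    (tendsto_gaussianFlux_fiberMap hH1 h0 hb)]

theorem mappingDegree_fiberedMap (hH : ContDiff ℝ 2 H) (h0 : ∀ t, H (circleMap 0 1 t, 0) ≠ 0) :
    mappingDegree (fun x => ‖fiberedMap H x‖⁻¹ • fiberedMap H x) * Real.pi =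
      gaussianFlux 0 fun t => H (circleMap 0 1 t, 0) := by
  have h := integral_gaussian_mul_det_fderiv_radialExtension
    (contDiff_fiberedMap (hH.of_le one_le_two)) fun x => fiberedMap_ne_zero h0
  have hplane : ∫ b : ℂ, Real.exp (-‖b‖ ^ 2) = Real.pi := by
    simpa using GaussianFourier.integral_rexp_neg_mul_sq_norm (V := ℂ) one_pos
  have hspace : ∫ x : EuclideanSpace ℝ (Fin 4), Real.exp (-‖x‖ ^ 2) = Real.pi ^ 2 := by
    have := GaussianFourier.integral_rexp_neg_mul_sq_norm
      (V := EuclideanSpace ℝ (Fin 4)) one_pos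
    norm_num at this
    exact_mod_cast this
  rw [integral_gaussian_mul_det_fderiv_radialExtension_fiberedMap hH h0, hplane, hspace] at h
  refine mul_left_cancel₀ Real.pi_ne_zero ?_
  rw [h]
  ring

end Fibered

/-! ### Mixed polynomials -/

namespace MixedPolynomial

theorem contDiff_value {n : ℕ} (F : MixedPolynomial n) {k : WithTop ℕ∞} : ContDiff ℝ k F.value := by
  unfold value
  induction F using MvPolynomial.induction_on with
  | C a => simpa using contDiff_const
  | add p q hp hq => simpa using hp.add hq
  | mul_X p i hp =>
    simp only [map_mul, MvPolynomial.eval_X]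
    refine hp.mul ?_
    cases i with
    | inl j => exact contDiff_apply ℝ ℂ j
    | inr j => exact conjCLE.contDiff.comp (contDiff_apply ℝ ℂ j)

theorem value_restrictLine (F : MixedPolynomial 2) (z : ℂ) :
    F.restrictLine.value ![z] = F.value ![z, 0] := by
  rw [value, restrictLine, ← MvPolynomial.aeval_eq_eval, MvPolynomial.aeval_bind₁,
    MvPolynomial.aeval_eq_eval, value]
  congr 2
  ext (j | j) <;> fin_cases j <;> simp

theorem value_z₂ (z : Fin 2 → ℂ) : z₂.value z = z 1 := by
  simp [value, z₂]

theorem mem_zeroSet_inter_zeroSet_z₂ (F : MixedPolynomial 2) (z b : ℂ) :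
    ![z, b] ∈ F.zeroSet ∩ z₂.zeroSet ↔ F.restrictLine.value ![z] = 0 ∧ b = 0 := by
  simp only [zeroSet, mem_inter_iff, mem_ofPred_eq, value_z₂, value_restrictLine]
  refine and_congr_left fun hb => ?_
  rw [show b = 0 from hb]

end MixedPolynomial

theorem toComplexPlane_planeEquiv (z b : ℂ) : toComplexPlane (planeEquiv (z, b)) = ![z, b] := by
  ext i
  fin_cases i <;> simp [planeEquiv, toRealSpace, toComplexPlane]

theorem dist_planeEquiv_mk_zero (z w : ℂ) :
    dist (planeEquiv (z, 0)) (planeEquiv (w, 0)) = dist z w := by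
  rw [dist_eq_norm, dist_eq_norm, ← map_sub, ← sq_eq_sq₀ (norm_nonneg _) (norm_nonneg _),
    norm_sq_planeEquiv]
  simp

theorem isOnlyIntersection_z₂_iff {F : MixedPolynomial 2} {α : ℂ} {ε : ℝ} :
    IsOnlyIntersection F MixedPolynomial.z₂ ![α, 0] ε ↔ IsOnlyRoot F.restrictLine α ε := by
  change (∀ x ∈ Metric.closedBall (planeEquiv (α, 0)) ε,
    toComplexPlane x ∈ F.zeroSet ∩ MixedPolynomial.z₂.zeroSet ↔ x = planeEquiv (α, 0)) ↔ _
  simp only [planeEquiv.surjective.forall, Prod.forall, toComplexPlane_planeEquiv,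
    F.mem_zeroSet_inter_zeroSet_z₂, planeEquiv.injective.eq_iff, Prod.mk.injEq,
    Metric.mem_closedBall]
  constructor
  · intro h z hz
    simpa using h z 0 (by rwa [dist_planeEquiv_mk_zero])
  · refine fun h z b hzb => and_congr_left ?_
    rintro rfl
    exact h z (by rwa [dist_planeEquiv_mk_zero] at hzb)

theorem exists_isOnlyRoot {f : MixedPolynomial 1} {α : ℂ} (hroot : f.value ![α] = 0)
    (hisolated : ∀ᶠ z in 𝓝[≠] α, f.value ![z] ≠ 0) : ∃ ε > 0, IsOnlyRoot f α ε := by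
  obtain ⟨ε, hε, hball⟩ := Metric.nhds_basis_closedBall.eventually_iff.1
    (eventually_nhdsWithin_iff.1 hisolated)
  exact ⟨ε, hε, fun z hz => ⟨fun h => by_contra fun hne => hball hz hne h, fun h => h ▸ hroot⟩⟩

theorem IsOnlyRoot.value_circleMap_ne_zero {f : MixedPolynomial 1} {α : ℂ} {ε : ℝ}
    (h : IsOnlyRoot f α ε) (hε : 0 < ε) (t : ℝ) : f.value ![circleMap α ε t] ≠ 0 :=
  fun h0 => circleMap_ne_center hε.ne' ((h _ (circleMap_mem_closedBall α hε.le t)).1 h0)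

theorem exists_forall_isOnlyRoot_hasWindingNumber (f : MixedPolynomial 1) (α : ℂ) :
    ∃ n : ℤ, ∀ ε > 0, IsOnlyRoot f α ε →
      gaussianFlux 0 (fun t => f.value ![circleMap α ε t]) = Real.pi * n ∧
        HasWindingNumber (normalizedLoop f α ε) n := by
  have hradii : IsPreconnected {ε : ℝ | 0 < ε ∧ IsOnlyRoot f α ε} :=
    OrdConnected.isPreconnected ⟨fun _ hx _ hy _ hr => ⟨hx.1.trans_le hr.1, fun z hz =>
      hy.2 z (Metric.closedBall_subset_closedBall hr.2 hz)⟩⟩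
  have hf : ContDiff ℝ 1 fun z : ℂ => f.value ![z] :=
    f.contDiff_value.comp (contDiff_pi.2 fun i => by fin_cases i; exact contDiff_id)
  obtain ⟨n, hn⟩ := exists_forall_hasWindingNumber hf hradii
    fun ε hε => hε.2.value_circleMap_ne_zero hε.1
  exact ⟨n, fun ε hε h => hn ε ⟨hε, h⟩⟩

/-- The mixed polynomial `F` around `(α, 0)`, in coordinates centred there and with the source and
the target rescaled by `ε`: rescaling the target too makes `(F, z₂)` fibered over `z₂`. -/
noncomputable def rescaledValue (F : MixedPolynomial 2) (α : ℂ) (ε : ℝ) (p : ℂ × ℂ) : ℂ :=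
  (ε : ℂ)⁻¹ * F.value ![α + ε * p.1, ε * p.2]

section Rescaled

variable (F : MixedPolynomial 2) (α : ℂ) (ε : ℝ)

theorem contDiff_rescaledValue {k : WithTop ℕ∞} : ContDiff ℝ k (rescaledValue F α ε) := by
  refine contDiff_const.mul (F.contDiff_value.comp (contDiff_pi.2 fun i => ?_))
  fin_cases i
  · exact contDiff_const.add (contDiff_const.mul contDiff_fst)
  · exact contDiff_const.mul contDiff_snd

theorem rescaledValue_circleMap (t : ℝ) : rescaledValue F α ε (circleMap 0 1 t, 0) =
    (ε : ℂ)⁻¹ * F.restrictLine.value ![circleMap α ε t] := by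
  simp [rescaledValue, F.value_restrictLine, circleMap]

variable {ε}

theorem realPair_z₂_eq_smul_fiberedMap (hε : 0 < ε) (x : EuclideanSpace ℝ (Fin 4)) :
    realPair F MixedPolynomial.z₂ (toRealSpace ![α, 0] + ε • x) =
      ε • fiberedMap (rescaledValue F α ε) x := by
  obtain ⟨⟨z, b⟩, rfl⟩ := planeEquiv.surjective x
  have hpoint : toRealSpace ![α, 0] + ε • planeEquiv (z, b) =
      planeEquiv (α + ε * z, ε * b) := by
    change planeEquiv (α, 0) + _ = _
    rw [← map_smul, ← map_add]
    simp
  rw [realPair, hpoint, toComplexPlane_planeEquiv, MixedPolynomial.value_z₂, fiberedMap,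
    ← map_smul]
  simp only [rescaledValue, ContinuousLinearEquiv.symm_apply_apply, Prod.smul_mk, real_smul,
    mul_inv_cancel_left₀ (ofReal_ne_zero.2 hε.ne')]
  rfl

theorem normalizedPair_z₂ (hε : 0 < ε) : normalizedPair F MixedPolynomial.z₂ ![α, 0] ε =
    fun x => ‖fiberedMap (rescaledValue F α ε) x‖⁻¹ • fiberedMap (rescaledValue F α ε) x := by
  ext1 x
  simp only [normalizedPair, realPair_z₂_eq_smul_fiberedMap F α hε]
  exact NormedSpace.normalize_smul_of_pos hε _

variable {F α}

theorem mappingDegree_normalizedPair_z₂ (hε : 0 < ε) (h : IsOnlyRoot F.restrictLine α ε) :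
    mappingDegree (normalizedPair F MixedPolynomial.z₂ ![α, 0] ε) * Real.pi =
      gaussianFlux 0 fun t => F.restrictLine.value ![circleMap α ε t] := by
  have hinv : (ε : ℂ)⁻¹ ≠ 0 := inv_ne_zero (ofReal_ne_zero.2 hε.ne')
  rw [normalizedPair_z₂ F α hε, mappingDegree_fiberedMap (contDiff_rescaledValue F α ε) fun t => by
    rw [rescaledValue_circleMap]
    exact mul_ne_zero hinv (h.value_circleMap_ne_zero hε t)]
  simp only [rescaledValue_circleMap, gaussianFlux_const_mul hinv, zero_div]

end Rescaled

theorem mainTheorem6 (F : MixedPolynomial 2) (α : ℂ)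
    (hroot : F.restrictLine.value ![α] = 0)
    (hisolated : ∀ᶠ z in nhdsWithin α {α}ᶜ, F.restrictLine.value ![z] ≠ 0) :
    ![α, 0] ∈ F.zeroSet ∩ MixedPolynomial.z₂.zeroSet ∧
      ∃ n : ℤ, HasIntersectionNumber F MixedPolynomial.z₂ ![α, 0] n ∧
        HasSignedMultiplicity F.restrictLine α n := by
  obtain ⟨n, hn⟩ := exists_forall_isOnlyRoot_hasWindingNumber F.restrictLine α
  have hex := exists_isOnlyRoot hroot hisolated
  refine ⟨(F.mem_zeroSet_inter_zeroSet_z₂ α 0).2 ⟨hroot, rfl⟩, n, ⟨?_, fun ε hε h => ?_⟩,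
    hex, fun ε hε h => (hn ε hε h).2⟩
  · simpa only [isOnlyIntersection_z₂_iff] using hex
  · rw [isOnlyIntersection_z₂_iff] at h
    refine mul_right_cancel₀ Real.pi_ne_zero ?_
    rw [mappingDegree_normalizedPair_z₂ hε h, (hn ε hε h).1, mul_comm]
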